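/- Let $\boldsymbol\xi$ be an $m$-dimensional random vector, $g:\mathbb{R}^m\times\mathbb{R}^n\to\mathbb{R}$ and $\hat x\in\mathbb{R}^n$. Suppose that (a) $\boldsymbol\xi$ has a finite distribution with outcomes $\xi^1,\dots,\xi^\nu$ and corresponding positive probabilities $p_1,\dots,p_\nu$; (b) for every $i$, the function $g(\xi^i,\cdot)$ is continuously differentiable in a neighborhood of $\hat x$; (c) $\mathbb{E}[g(\boldsymbol\xi,\hat x)]<0$, and $g(\xi^i,\hat x)>0$ for some $i$. For an integrable random variable $Z$ let $q_\alpha=\min\{z : \mathrm{prob}\{Z\le z\}\ge\alpha\}$ be its $\alpha$-quantile for $\alpha\in(0,1)$, and let its $\alpha$-superquantile be $\bar q_\alpha=q_\alpha+\frac{1}{1-\alpha}\mathbb{E}[\max\{0,Z-q_\alpha\}]$ for $\alpha\in(0,1)$, $\bar q_0=\mathbb{E}[Z]$ and $\bar q_1=\lim_{\alpha\nearrow 1}\bar q_\alpha$. The buffered failure probability $\bar p(x)$ is defined with $Z=g(\boldsymbol\xi,x)$ as follows: $\bar p(x)=0$ if $\mathrm{prob}\{Z>0\}=0$; $\bar p(x)=1-\bar\alpha$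 if $\mathrm{prob}\{Z>0\}>0$ and $\mathbb{E}[Z]<0$, where $\bar\alpha\in[0,1]$ is the level with $\bar q_{\bar\alpha}=0$; and $\bar p(x)=1$ otherwise. Let $\Gamma(\hat x)$ be the set of minimizers of $\gamma\mapsto\mathbb{E}[\max\{0,\gamma g(\boldsymbol\xi,\hat x)+1\}]$ over $\gamma\ge 0$. Let $\partial\bar p(\hat x)$ be the set of limiting (Mordukhovich) subgradients of $\bar p$ at $\hat x$, that is, of all limits $y=\lim_k v^k$ with $x^k\to\hat x$, $\bar p(x^k)\to\bar p(\hat x)$ and, for each $k$, $\bar p(x)\ge\bar p(x^k)+\langle v^k,x-x^k\rangle+o(\|x-x^k\|)$ as $x\to x^k$. If $y\in\partial\bar p(\hat x)$, then there are $\hat\gamma\in\Gamma(\hat x)$ and multipliers $\mu_1,\dots,\mu_\nu\in[0,1]$ such that $$y=\hat\gamma\sum_{i=1}^\nu p_i\mu_i\nabla_x g(\xi^i,\hat x),\qquad \sum_{i=1}^\nu p_i\mu_i g(\xi^i,\hat x)=0,$$ and, for every $i$, $\mu_i=0$ if $\hat\gamma g(\xi^i,\hat x)+1<0$, and $\mu_i=1$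 if $\hat\gamma g(\xi^i,\hat x)+1>0$. -/

import Mathlib

open MeasureTheory Filter Topology

noncomputable section

/-- The failure probability `prob {Z > 0}` of a random variable `Z`. -/
def failureProb {Ω : Type*} [MeasurableSpace Ω] (P : Measure Ω) (Z : Ω → ℝ) : ℝ :=
  P.real {ω | 0 < Z ω}

/-- The `α`-quantile of `Z`, for `0 < α < 1`: the smallest `z` with `prob {Z ≤ z} ≥ α`. -/
def quantile {Ω : Type*} [MeasurableSpace Ω] (P : Measure Ω) (Z : Ω → ℝ) (α : ℝ) : ℝ :=
  sInf {z : ℝ | α ≤ P.real {ω | Z ω ≤ z}}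

/-- The `α`-superquantile of `Z` for `0 < α < 1`:
`q_α + (1 - α)⁻¹ E[max {0, Z - q_α}]`, with `q_α` the `α`-quantile. -/
def innerSuperquantile {Ω : Type*} [MeasurableSpace Ω] (P : Measure Ω) (Z : Ω → ℝ) (α : ℝ) : ℝ :=
  quantile P Z α + 1 / (1 - α) * ∫ ω, max 0 (Z ω - quantile P Z α) ∂P

/-- The `α`-superquantile of an integrable `Z` for `0 ≤ α ≤ 1`. At `α = 0` it is the mean of `Z`
(the value of the defining formula when the `0`-quantile is the essential infimum, and its limit
as `α` decreases to `0`); at `α = 1` it is the limit from the left, which may be `+∞`. -/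
def superquantile {Ω : Type*} [MeasurableSpace Ω] (P : Measure Ω) (Z : Ω → ℝ) (α : ℝ) : EReal :=
  if α = 0 then ((∫ ω, Z ω ∂P : ℝ) : EReal)
  else if α < 1 then (innerSuperquantile P Z α : EReal)
  else limUnder (𝓝[<] (1 : ℝ)) (fun β : ℝ => (innerSuperquantile P Z β : EReal))

/-- The probability level `α ∈ [0, 1]` at which the `α`-superquantile of `Z` is zero. It is unique
when `Z` is integrable with `prob {Z > 0} > 0` and `E[Z] < 0`. -/
def zeroLevel {Ω : Type*} [MeasurableSpace Ω] (P : Measure Ω) (Z : Ω → ℝ) : ℝ :=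
  sInf {α : ℝ | α ∈ Set.Icc 0 1 ∧ superquantile P Z α = 0}

open Classical in
/-- The buffered probability of `{Z > 0}` for an integrable random variable `Z`. -/
def bufferedProb {Ω : Type*} [MeasurableSpace Ω] (P : Measure Ω) (Z : Ω → ℝ) : ℝ :=
  if failureProb P Z = 0 then 0
  else if ∫ ω, Z ω ∂P < 0 then 1 - zeroLevel P Z
  else 1

/-- The set of minimizers of `γ ↦ E[max {0, γ Z + 1}]` over `γ ≥ 0`. -/
def bufferedArgmin {Ω : Type*} [MeasurableSpace Ω] (P : Measure Ω) (Z : Ω → ℝ) : Set ℝ :=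
  {γ : ℝ | 0 ≤ γ ∧ IsMinOn (fun t : ℝ => ∫ ω, max 0 (t * Z ω + 1) ∂P) (Set.Ici 0) γ}

/-- `v` is a regular (Fréchet) subgradient of the real-valued `f` at `x`:
`f z ≥ f x + ⟨v, z - x⟩ + o(‖z - x‖)`. -/
def IsRegularSubgradient {E : Type*} [NormedAddCommGroup E] [InnerProductSpace ℝ E]
    (f : E → ℝ) (x v : E) : Prop :=
  ∀ ε : ℝ, 0 < ε → ∀ᶠ z in 𝓝 x, f x + inner ℝ v (z - x) - ε * ‖z - x‖ ≤ f z

/-- The limiting (Mordukhovich) subdifferential of the real-valued `f` at `x`: limits of regular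
subgradients `v k` of `f` at points `u k` with `u k → x` and `f (u k) → f x`. -/
def limitingSubdifferential {E : Type*} [NormedAddCommGroup E] [InnerProductSpace ℝ E]
    (f : E → ℝ) (x : E) : Set E :=
  {y : E | ∃ (u v : ℕ → E), Tendsto u atTop (𝓝 x) ∧ Tendsto (fun k => f (u k)) atTop (𝓝 (f x)) ∧
    (∀ k, IsRegularSubgradient f (u k) (v k)) ∧ Tendsto v atTop (𝓝 y)}

end

/-!
Near `xhat` the buffered probability is the marginal function
`x ↦ min_{γ ≥ 0} E[max {0, γ g(ξ, x) + 1}]`. The reason is the Rockafellar–Uryasev formula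
(`HasFiniteLaw.innerSuperquantile_le`): the substitution `c = -1/γ` turns its objective
`c + (1 - α)⁻¹ E[max {0, Z - c}]` into `γ⁻¹ ((1 - α)⁻¹ E[max {0, γ Z + 1}] - 1)`, so that the
superquantile vanishes exactly at the level `α` for which `1 - α` is the minimum
(`HasFiniteLaw.bufferedProb_eq`). For a finitely supported `Z` the quantile is an atom of `Z`, and
all expectations are finite sums.

At a regular subgradient `v` of the marginal function at `u`, with minimizer `γ > 0`, the pair
`(0, v)` is a regular subgradient in `(γ, x)` of the joint objective, a nonnegative combination of
functions `max 0 ψ` with `ψ` differentiable. Its directional derivative is the support function of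
the compact convex set of all `∑ i, p i μ i (g i, γ ∇g i)` with `μ i` in the subdifferential of
`max 0` at `γ g i + 1`; by separation `(0, v)` belongs to that set
(`IsRegularSubgradient.exists_multipliers`).

The minimizers stay bounded because some outcome has `g > 0` at `xhat`, hence `g ≥ δ > 0` nearby,
and the multipliers lie in `[0, 1]`. A convergent subsequence of both gives the multipliers for a
limiting subgradient, since every relation involved is closed in the limit.
-/

/-! ### Random variables with a finite law -/

/-- `Z` takes the values `z i` with probabilities `p i` (repeated values are allowed): probabilities
and expectations of functions of `Z` are the corresponding finite sums. Measurability of `Z` is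
not part of the definition, since `g (ξ ω) x` need not be measurable when `g` is arbitrary. -/
structure HasFiniteLaw {Ω ι : Type*} [MeasurableSpace Ω] [Fintype ι] (P : Measure Ω) (Z : Ω → ℝ)
    (p z : ι → ℝ) : Prop where
  integral_comp : ∀ h : ℝ → ℝ, ∫ ω, h (Z ω) ∂P = ∑ i, p i * h (z i)
  measureReal : ∀ S : Set ℝ, P.real {ω | Z ω ∈ S} = ∑ i, p i * S.indicator 1 (z i)

theorem hasFiniteLaw_comp {Ω E ι : Type*} [MeasurableSpace Ω] [MeasurableSpace E]
    [MeasurableSingletonClass E] [Fintype ι] {P : Measure Ω} {ξ : Ω → E} (hξ : Measurable ξ)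
    {e : ι → E} {p : ι → ℝ} (hp : ∀ i, 0 ≤ p i)
    (hlaw : P.map ξ = ∑ i, ENNReal.ofReal (p i) • Measure.dirac (e i)) (f : E → ℝ) :
    HasFiniteLaw P (fun ω => f (ξ ω)) p (fun i => f (e i)) := by
  have hsupp : ∀ᵐ x ∂(P.map ξ), x ∈ Set.range e := by
    rw [hlaw, ae_iff]
    simp
  -- On the finite support, every function agrees with a measurable one.
  have haesm (k : E → ℝ) : AEStronglyMeasurable k (P.map ξ) := by
    have hfin : (Set.range e).Finite := Set.finite_range e
    refine ⟨(Set.range e).indicator k, ?_, ?_⟩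
    · refine Measurable.stronglyMeasurable ?_
      have := hfin.to_subtype
      refine measurable_of_restrict_of_restrict_compl hfin.measurableSet ?_ ?_
      · exact measurable_of_finite _
      · convert measurable_const (a := (0 : ℝ)) using 1
        ext x
        simpa using fun i hi => absurd ⟨i, hi⟩ x.2
    · filter_upwards [hsupp] with x hx
      rw [Set.indicator_of_mem hx]
  have hint (k : E → ℝ) : ∫ ω, k (ξ ω) ∂P = ∑ i, p i * k (e i) := by
    rw [← integral_map hξ.aemeasurable (haesm k), hlaw, integral_finsetSum_measure]
    · simp [integral_smul_measure, hp]
    · intro i _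
      exact (integrable_dirac (by simp)).smul_measure (by simp)
  refine ⟨fun h => hint fun x => h (f x), fun S => ?_⟩
  have hnull : NullMeasurableSet {ω | f (ξ ω) ∈ S} P := by
    have hA : MeasurableSet (f ⁻¹' S ∩ Set.range e) :=
      ((Set.finite_range e).inter_of_right _).measurableSet
    refine (hξ hA).nullMeasurableSet.congr ?_
    filter_upwards [ae_of_ae_map hξ.aemeasurable hsupp] with ω hω
    exact propext ⟨fun h => h.1, fun h => ⟨h, hω⟩⟩
  have hS := hint fun x => S.indicator 1 (f x)
  rw [← hS]
  have : (fun ω => S.indicator (1 : ℝ → ℝ) (f (ξ ω))) = {ω | f (ξ ω) ∈ S}.indicator 1 := by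
    ext ω; simp [Set.indicator]
  rw [this, integral_indicator₀ hnull]
  simp

/-! ### The minimization formula for finite laws -/

/-- The objective `E[max {0, γ Z + 1}]` for `Z` with values `z i` of probabilities `p i`. -/
noncomputable def bufferedObjective {ι : Type*} [Fintype ι] (p z : ι → ℝ) (γ : ℝ) : ℝ :=
  ∑ i, p i * max 0 (γ * z i + 1)

section Finite

variable {Ω ι : Type*} [MeasurableSpace Ω] [Fintype ι] {P : Measure Ω} {Z : Ω → ℝ} {p z : ι → ℝ}

theorem HasFiniteLaw.sum_eq_one [IsProbabilityMeasure P] (h : HasFiniteLaw P Z p z) :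
    ∑ i, p i = 1 := by
  simpa using (h.integral_comp fun _ => 1).symm

theorem HasFiniteLaw.integral_eq (h : HasFiniteLaw P Z p z) :
    ∫ ω, Z ω ∂P = ∑ i, p i * z i :=
  h.integral_comp id

theorem bufferedObjective_zero (hsum : ∑ i, p i = 1) : bufferedObjective p z 0 = 1 := by
  simp [bufferedObjective, hsum]

theorem bufferedObjective_ge (hp : ∀ i, 0 ≤ p i) (j : ι) (γ : ℝ) :
    p j * (γ * z j + 1) ≤ bufferedObjective p z γ :=
  (mul_le_mul_of_nonneg_left (le_max_right _ _) (hp j)).trans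
    (Finset.single_le_sum (f := fun i => p i * max 0 (γ * z i + 1))
      (fun i _ => mul_nonneg (hp i) (le_max_left _ _)) (Finset.mem_univ j))

theorem bufferedObjective_exists_lt_one (hsum : ∑ i, p i = 1) (hmean : ∑ i, p i * z i < 0) :
    ∃ t, 0 ≤ t ∧ bufferedObjective p z t < 1 := by
  -- For this `t` all the terms `t * z i + 1` are nonnegative, so the objective is `1 + t E[Z]`.
  have hs : 0 ≤ ∑ i, |z i| := Finset.sum_nonneg fun i _ => abs_nonneg _
  set t := (1 + ∑ i, |z i|)⁻¹
  have ht0 : 0 < t := by positivity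
  refine ⟨t, ht0.le, ?_⟩
  have key : ∀ i, max 0 (t * z i + 1) = t * z i + 1 := fun i => by
    have h1 : |z i| ≤ ∑ i, |z i| :=
      Finset.single_le_sum (f := fun i => |z i|) (fun i _ => abs_nonneg _) (Finset.mem_univ i)
    have h2 : t * (1 + ∑ i, |z i|) = 1 := inv_mul_cancel₀ (by positivity)
    have h3 := neg_abs_le (z i)
    exact max_eq_right (by nlinarith)
  have : bufferedObjective p z t = t * (∑ i, p i * z i) + ∑ i, p i := by
    simp only [bufferedObjective, key, Finset.mul_sum, ← Finset.sum_add_distrib]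
    exact Finset.sum_congr rfl fun i _ => by ring
  rw [this, hsum]
  nlinarith

theorem bufferedObjective_exists_min (hp : ∀ i, 0 < p i) (hsum : ∑ i, p i = 1)
    (hmean : ∑ i, p i * z i < 0) (hpos : ∃ i, 0 < z i) :
    ∃ γ, 0 < γ ∧ bufferedObjective p z γ < 1 ∧
      ∀ t, 0 ≤ t → bufferedObjective p z γ ≤ bufferedObjective p z t := by
  obtain ⟨j, hj⟩ := hpos
  have hpj := hp j
  set R := 1 / (p j * z j) with hR
  have hR0 : 0 ≤ R := by positivity
  have hcont : Continuous (bufferedObjective p z) := by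
    unfold bufferedObjective; fun_prop
  obtain ⟨γ, hγ, hmin⟩ := isCompact_Icc.exists_isMinOn (Set.nonempty_Icc.2 hR0) hcont.continuousOn
  have h0 := bufferedObjective_zero (z := z) hsum
  have hmin' : ∀ t, 0 ≤ t → bufferedObjective p z γ ≤ bufferedObjective p z t := fun t ht => by
    rcases le_or_gt t R with h | h
    · exact hmin ⟨ht, h⟩
    · -- Beyond `R` the `j`-th term alone exceeds the value `1` at the origin.
      have h1 : bufferedObjective p z γ ≤ bufferedObjective p z 0 := hmin ⟨le_rfl, hR0⟩
      have h2 := bufferedObjective_ge (z := z) (fun i => (hp i).le) j t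
      have h3 : R * (p j * z j) = 1 := by rw [hR]; field_simp
      have h4 : 0 < p j * z j := by positivity
      nlinarith
  obtain ⟨t, ht, ht1⟩ := bufferedObjective_exists_lt_one hsum hmean
  have hlt := (hmin' t ht).trans_lt ht1
  refine ⟨γ, hγ.1.lt_of_ne ?_, hlt, hmin'⟩
  rintro rfl
  linarith

/-- The quantile of a finitely supported variable is attained, and is characterized by the usual
two inequalities. -/
theorem HasFiniteLaw.quantile_spec [IsProbabilityMeasure P] (h : HasFiniteLaw P Z p z)
    {α : ℝ} (h0 : 0 < α) (h1 : α < 1) :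
    α ≤ ∑ i, p i * (Set.Iic (quantile P Z α)).indicator 1 (z i) ∧
      ∑ i, p i * (Set.Iio (quantile P Z α)).indicator 1 (z i) ≤ α := by
  set S : Set ℝ := {c | α ≤ ∑ i, p i * (Set.Iic c).indicator 1 (z i)}
  have hq : quantile P Z α = sInf S := by
    unfold quantile
    congr 1
    ext c
    exact iff_of_eq (congrArg (α ≤ ·) (h.measureReal (Set.Iic c)))
  -- Rounding `c` down to an atom of `Z` does not change the distribution function.
  have round : ∀ T : Set ℝ, IsLowerSet T → α ≤ ∑ i, p i * T.indicator 1 (z i) →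
      ∃ j, z j ∈ T ∧ z j ∈ S := fun T hT hle => by
    classical
    have hne : (Finset.univ.filter fun i => z i ∈ T).Nonempty := by
      by_contra hcon
      rw [Finset.not_nonempty_iff_eq_empty, Finset.filter_eq_empty_iff] at hcon
      have : ∑ i, p i * T.indicator 1 (z i) = 0 :=
        Finset.sum_eq_zero fun i hi => by simp [hcon hi]
      linarith
    obtain ⟨j, hj, hmax⟩ := Finset.exists_max_image _ z hne
    simp only [Finset.mem_filter, Finset.mem_univ, true_and] at hj hmax
    refine ⟨j, hj, hle.trans_eq (Finset.sum_congr rfl fun i _ => ?_)⟩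
    have : z i ∈ T ↔ z i ∈ Set.Iic (z j) := ⟨hmax i, fun hi => hT hi hj⟩
    by_cases hi : z i ∈ T
    · rw [Set.indicator_of_mem hi, Set.indicator_of_mem (this.1 hi)]
    · rw [Set.indicator_of_notMem hi, Set.indicator_of_notMem (mt this.2 hi)]
  have hmono : ∀ c ∈ S, ∃ j, z j ≤ c ∧ z j ∈ S := fun c hc => round _ (isLowerSet_Iic c) hc
  have huniv : ∃ j, z j ∈ S := by
    obtain ⟨j, -, hj⟩ := round Set.univ isLowerSet_univ (by simpa [h.sum_eq_one] using h1.le)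
    exact ⟨j, hj⟩
  classical
  obtain ⟨j, hj, hmin⟩ := Finset.exists_min_image (Finset.univ.filter fun i => z i ∈ S) z
    (by obtain ⟨j, hj⟩ := huniv; exact ⟨j, by simpa using hj⟩)
  replace hj : z j ∈ S := by simpa using hj
  have hleast : IsLeast S (z j) := ⟨hj, fun c hc => by
    obtain ⟨k, hk, hkS⟩ := hmono c hc
    exact (hmin k (by simpa using hkS)).trans hk⟩
  rw [hq, hleast.csInf_eq]
  refine ⟨hj, ?_⟩
  by_contra! hcon
  obtain ⟨k, hk, hkS⟩ := round _ (isLowerSet_Iio (z j)) hcon.le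
  exact (hleast.2 hkS).not_gt hk

theorem HasFiniteLaw.innerSuperquantile_eq (h : HasFiniteLaw P Z p z) (α : ℝ) :
    innerSuperquantile P Z α =
      quantile P Z α + 1 / (1 - α) * ∑ i, p i * max 0 (z i - quantile P Z α) := by
  unfold innerSuperquantile
  rw [h.integral_comp fun t => max 0 (t - quantile P Z α)]

/-- The Rockafellar–Uryasev formula: the `α`-superquantile, which is the value of
`c + (1 - α)⁻¹ E[max {0, Z - c}]` at the quantile, is its minimum over `c`. -/
theorem HasFiniteLaw.innerSuperquantile_le [IsProbabilityMeasure P] (h : HasFiniteLaw P Z p z)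
    (hp : ∀ i, 0 ≤ p i) {α : ℝ} (h0 : 0 < α) (h1 : α < 1) (c : ℝ) :
    innerSuperquantile P Z α ≤ c + 1 / (1 - α) * ∑ i, p i * max 0 (z i - c) := by
  obtain ⟨hle, hlt⟩ := h.quantile_spec h0 h1
  rw [h.innerSuperquantile_eq]
  set q := quantile P Z α
  have hsum := h.sum_eq_one
  suffices hs : ∑ i, p i * max 0 (z i - q) ≤
      (1 - α) * (c - q) + ∑ i, p i * max 0 (z i - c) by
    have hα : 0 < 1 - α := by linarith
    have h2 := mul_le_mul_of_nonneg_left hs (one_div_pos.2 hα).le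
    rw [mul_add, ← mul_assoc, one_div_mul_cancel hα.ne'] at h2
    linarith
  rcases le_total q c with hqc | hqc
  · calc ∑ i, p i * max 0 (z i - q)
        ≤ ∑ i, (p i * max 0 (z i - c) +
            (c - q) * (p i - p i * (Set.Iic q).indicator 1 (z i))) := by
          refine Finset.sum_le_sum fun i _ => ?_
          have : max 0 (z i - q) ≤
              max 0 (z i - c) + (c - q) * (1 - (Set.Iic q).indicator 1 (z i)) := by
            rcases le_or_gt (z i) q with hz | hz
            · simp [hz]
            · have : z i ∉ Set.Iic q := by simpa using hz
              rw [Set.indicator_of_notMem this]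
              refine max_le ?_ ?_
              · have := le_max_left 0 (z i - c); linarith
              · have := le_max_right 0 (z i - c); linarith
          nlinarith [mul_le_mul_of_nonneg_left this (hp i)]
      _ ≤ _ := by
          rw [Finset.sum_add_distrib, ← Finset.mul_sum, Finset.sum_sub_distrib, hsum]
          nlinarith
  · calc ∑ i, p i * max 0 (z i - q)
        ≤ ∑ i, (p i * max 0 (z i - c) +
            (c - q) * (p i - p i * (Set.Iio q).indicator 1 (z i))) := by
          refine Finset.sum_le_sum fun i _ => ?_
          have : max 0 (z i - q) ≤
              max 0 (z i - c) + (c - q) * (1 - (Set.Iio q).indicator 1 (z i)) := by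
            rcases lt_or_ge (z i) q with hz | hz
            · simp [hz, hz.le]
            · have : z i ∉ Set.Iio q := by simpa using hz
              rw [Set.indicator_of_notMem this, max_eq_right (by linarith : 0 ≤ z i - q)]
              have := le_max_right 0 (z i - c); linarith
          nlinarith [mul_le_mul_of_nonneg_left this (hp i)]
      _ ≤ _ := by
          rw [Finset.sum_add_distrib, ← Finset.mul_sum, Finset.sum_sub_distrib, hsum]
          nlinarith

/-- Under the substitution `c = -1/γ` the Rockafellar–Uryasev objective becomes the one of the
buffered probability. -/
theorem sum_max_sub_neg_inv {γ : ℝ} (hγ : 0 < γ) :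
    ∑ i, p i * max 0 (z i - -(1 / γ)) = 1 / γ * bufferedObjective p z γ := by
  rw [bufferedObjective, Finset.mul_sum]
  refine Finset.sum_congr rfl fun i _ => ?_
  have : z i - -(1 / γ) = 1 / γ * (γ * z i + 1) := by field_simp; ring
  rw [this, mul_left_comm, mul_max_of_nonneg _ _ (one_div_pos.2 hγ).le, mul_zero]

/-- The superquantile vanishes exactly at the level `1 - min bufferedObjective`. -/
theorem HasFiniteLaw.innerSuperquantile_eq_zero_iff [IsProbabilityMeasure P]
    (h : HasFiniteLaw P Z p z) (hp : ∀ i, 0 < p i) (hpos : ∃ i, 0 < z i) {γ : ℝ} (hγ : 0 < γ)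
    (hmin : ∀ t, 0 ≤ t → bufferedObjective p z γ ≤ bufferedObjective p z t)
    {α : ℝ} (h0 : 0 < α) (h1 : α < 1) :
    innerSuperquantile P Z α = 0 ↔ α = 1 - bufferedObjective p z γ := by
  have hα : 0 < 1 - α := by linarith
  have heq := h.innerSuperquantile_eq α
  set q := quantile P Z α
  have hnn : 0 ≤ ∑ i, p i * max 0 (z i - q) :=
    Finset.sum_nonneg fun i _ => mul_nonneg (hp i).le (le_max_left _ _)
  have hub := h.innerSuperquantile_le (fun i => (hp i).le) h0 h1 (-(1 / γ))
  rw [sum_max_sub_neg_inv hγ] at hub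
  have hγ' : 0 < 1 / γ := one_div_pos.2 hγ
  have hα' : 0 < 1 / (1 - α) := one_div_pos.2 hα
  have hcancel : 1 / (1 - α) * (1 - α) = 1 := one_div_mul_cancel hα.ne'
  constructor
  · intro hz
    -- The quantile is negative, and `-1/q` attains the value `1 - α`.
    have hq : q < 0 := by
      rcases lt_or_ge q 0 with hq | hq
      · exact hq
      obtain ⟨j, hj⟩ := hpos
      have hs0 : 0 ≤ 1 / (1 - α) * ∑ i, p i * max 0 (z i - q) := mul_nonneg hα'.le hnn
      have hq0 : q = 0 := by linarith
      have hge := Finset.single_le_sum (f := fun i => p i * max 0 (z i - q))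
        (fun i _ => mul_nonneg (hp i).le (le_max_left _ _)) (Finset.mem_univ j)
      simp only [hq0, sub_zero, max_eq_right hj.le] at hge
      have hjj := mul_pos (hp j) hj
      have : 0 < 1 / (1 - α) * ∑ i, p i * max 0 (z i - q) := by
        refine mul_pos hα' ?_
        simp only [hq0, sub_zero]
        linarith
      linarith
    have hq' : 0 < -(1 / q) := by
      rw [← one_div_neg_eq_neg_one_div]; exact one_div_pos.2 (by linarith)
    have hqq : q = -(1 / -(1 / q)) := by field_simp
    have hval := sum_max_sub_neg_inv (p := p) (z := z) hq'
    rw [← hqq] at hval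
    have hinv : 1 / -(1 / q) = -q := by linarith
    rw [hz, hval, hinv] at heq
    have hle := hmin _ hq'.le
    have hup : bufferedObjective p z (-(1 / q)) = 1 - α := by
      have h3 : q * (1 - 1 / (1 - α) * bufferedObjective p z (-(1 / q))) = 0 := by linarith
      rcases mul_eq_zero.1 h3 with h4 | h4
      · exact absurd h4 hq.ne
      · have : (1 - α) * (1 / (1 - α) * bufferedObjective p z (-(1 / q))) = 1 - α := by
          rw [show 1 / (1 - α) * bufferedObjective p z (-(1 / q)) = 1 by linarith, mul_one]
        rwa [← mul_assoc, mul_one_div_cancel hα.ne', one_mul] at this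
    have hlow : 1 - α ≤ bufferedObjective p z γ := by
      rw [hz] at hub
      have h3 : 0 ≤ 1 / γ * (1 / (1 - α) * bufferedObjective p z γ - 1) := by linarith
      have h4 := nonneg_of_mul_nonneg_right h3 hγ'
      have h5 : 1 / (1 - α) * (1 - α) ≤ 1 / (1 - α) * bufferedObjective p z γ := by linarith
      exact le_of_mul_le_mul_left h5 hα'
    linarith
  · intro hαeq
    have hobj : bufferedObjective p z γ = 1 - α := by linarith
    refine le_antisymm ?_ ?_
    · rw [hobj] at hub
      have : 1 / (1 - α) * (1 / γ * (1 - α)) = 1 / γ := by field_simp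
      linarith
    · rw [heq]
      rcases lt_or_ge q 0 with hq | hq
      · have hq' : 0 < -(1 / q) := by
          rw [← one_div_neg_eq_neg_one_div]; exact one_div_pos.2 (by linarith)
        have hqq : q = -(1 / -(1 / q)) := by field_simp
        have hval := sum_max_sub_neg_inv (p := p) (z := z) hq'
        rw [← hqq] at hval
        have hinv : 1 / -(1 / q) = -q := by linarith
        rw [hval, hinv]
        have h3 := mul_le_mul_of_nonneg_left (hmin _ hq'.le) hα'.le
        rw [hobj, hcancel] at h3
        nlinarith
      · have : 0 ≤ 1 / (1 - α) * ∑ i, p i * max 0 (z i - q) := mul_nonneg hα'.le hnn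
        linarith

/-- The `1`-superquantile of a finitely supported variable is its largest value. -/
theorem HasFiniteLaw.superquantile_one_ne_zero [IsProbabilityMeasure P]
    (h : HasFiniteLaw P Z p z) (hp : ∀ i, 0 < p i) (hpos : ∃ i, 0 < z i) :
    superquantile P Z 1 ≠ 0 := by
  obtain ⟨i, hi⟩ := hpos
  obtain ⟨j, -, hmax⟩ := Finset.exists_max_image Finset.univ z ⟨i, Finset.mem_univ i⟩
  have hjpos : 0 < z j := hi.trans_le (hmax i (Finset.mem_univ i))
  have hsum := h.sum_eq_one
  -- At levels above `1 - p j`, the quantile and the superquantile are both the largest value.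
  have hev : ∀ᶠ β in 𝓝[<] (1 : ℝ), innerSuperquantile P Z β = z j := by
    have hlt : max 0 (1 - p j) < 1 := max_lt one_pos (by linarith [hp j])
    filter_upwards [Ioo_mem_nhdsLT hlt] with β hβ
    have hβ0 : 0 < β := (le_max_left _ _).trans_lt hβ.1
    have hβj : 1 - p j < β := (le_max_right _ _).trans_lt hβ.1
    obtain ⟨hle, hge⟩ := h.quantile_spec hβ0 hβ.2
    have hq : quantile P Z β = z j := by
      rcases lt_trichotomy (quantile P Z β) (z j) with hlt | heq | hgt
      · have hs : ∑ i, p i * (Set.Iic (quantile P Z β)).indicator 1 (z i) + p j ≤ ∑ i, p i := by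
          have hind : ∀ i, p i * (Set.Iic (quantile P Z β)).indicator 1 (z i) ≤ p i := fun i =>
            mul_le_of_le_one_right (hp i).le (Set.indicator_le_self' (by simp) _ |>.trans (by simp))
          classical
          rw [← Finset.add_sum_erase _ _ (Finset.mem_univ j),
            ← Finset.add_sum_erase _ p (Finset.mem_univ j)]
          have hj0 : (Set.Iic (quantile P Z β)).indicator (1 : ℝ → ℝ) (z j) = 0 :=
            Set.indicator_of_notMem (by simpa using hlt) _
          have := Finset.sum_le_sum (s := Finset.univ.erase j) fun i _ => hind i
          rw [hj0]
          linarith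
        linarith
      · exact heq
      · have : ∑ i, p i * (Set.Iio (quantile P Z β)).indicator 1 (z i) = ∑ i, p i :=
          Finset.sum_congr rfl fun i _ => by
            rw [Set.indicator_of_mem (by simpa using (hmax i (Finset.mem_univ i)).trans_lt hgt)]
            simp
        linarith [hβ.2]
    rw [h.innerSuperquantile_eq, hq, Finset.sum_eq_zero, mul_zero, add_zero]
    intro i _
    rw [max_eq_left (by linarith [hmax i (Finset.mem_univ i)]), mul_zero]
  have hlim : Tendsto (fun β : ℝ => (innerSuperquantile P Z β : EReal)) (𝓝[<] 1)
      (𝓝 ((z j : ℝ) : EReal)) :=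
    tendsto_const_nhds.congr' (hev.mono fun β hβ => by simp only [hβ])
  have hval : superquantile P Z 1 = ((z j : ℝ) : EReal) := by
    simp only [superquantile, one_ne_zero, if_false, lt_irrefl]
    exact hlim.limUnder_eq
  rw [hval]
  exact_mod_cast hjpos.ne'

/-- The minimization formula for the buffered probability. The minimum is attained because
`prob {Z > 0} > 0` makes the objective coercive, and at a positive `γ` because `E[Z] < 0` is its
right derivative at the origin. -/
theorem HasFiniteLaw.bufferedProb_eq [IsProbabilityMeasure P] (h : HasFiniteLaw P Z p z)
    (hp : ∀ i, 0 < p i) (hmean : ∑ i, p i * z i < 0) (hpos : ∃ i, 0 < z i) :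
    ∃ γ, 0 < γ ∧ bufferedProb P Z = bufferedObjective p z γ ∧
      ∀ t, 0 ≤ t → bufferedObjective p z γ ≤ bufferedObjective p z t := by
  obtain ⟨γ, hγ, hlt, hmin⟩ := bufferedObjective_exists_min hp h.sum_eq_one hmean hpos
  refine ⟨γ, hγ, ?_, hmin⟩
  have hobj : 0 < bufferedObjective p z γ := by
    obtain ⟨j, hj⟩ := hpos
    have := bufferedObjective_ge (z := z) (fun i => (hp i).le) j γ
    have h2 : 0 < p j * (γ * z j + 1) := mul_pos (hp j) (by positivity)
    linarith
  have hfail : failureProb P Z ≠ 0 := by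
    obtain ⟨j, hj⟩ := hpos
    have hge := Finset.single_le_sum (f := fun i => p i * (Set.Ioi 0).indicator 1 (z i))
      (fun i _ => mul_nonneg (hp i).le (Set.indicator_nonneg (by simp) _)) (Finset.mem_univ j)
    have h2 : failureProb P Z = ∑ i, p i * (Set.Ioi (0 : ℝ)).indicator 1 (z i) :=
      h.measureReal (Set.Ioi 0)
    have h3 : (Set.Ioi (0 : ℝ)).indicator (1 : ℝ → ℝ) (z j) = 1 := Set.indicator_of_mem hj _
    simp only [h3, mul_one] at hge
    rw [h2]
    exact ((hp j).trans_le hge).ne'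
  have hset : {α : ℝ | α ∈ Set.Icc 0 1 ∧ superquantile P Z α = 0} =
      {1 - bufferedObjective p z γ} := by
    ext α
    simp only [Set.mem_ofPred_eq, Set.mem_singleton_iff, Set.mem_Icc]
    constructor
    · rintro ⟨⟨h0, h1⟩, hz⟩
      rcases h0.eq_or_lt with rfl | h0
      · simp only [superquantile, if_true, h.integral_eq] at hz
        exact absurd (by exact_mod_cast hz) hmean.ne
      rcases h1.eq_or_lt with rfl | h1
      · exact absurd hz (h.superquantile_one_ne_zero hp hpos)
      simp only [superquantile, h0.ne', h1, if_true, if_false] at hz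
      exact (h.innerSuperquantile_eq_zero_iff hp hpos hγ hmin h0 h1).1 (by exact_mod_cast hz)
    · intro hα
      have h0 : 0 < α := by linarith
      have h1 : α < 1 := by linarith
      refine ⟨⟨h0.le, h1.le⟩, ?_⟩
      simp only [superquantile, h0.ne', h1, if_true, if_false]
      exact_mod_cast (h.innerSuperquantile_eq_zero_iff hp hpos hγ hmin h0 h1).2 hα
  have hmean' : ∫ ω, Z ω ∂P < 0 := by rwa [h.integral_eq]
  rw [bufferedProb, if_neg hfail, if_pos hmean', zeroLevel, hset, csInf_singleton]
  ring

end Finite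

/-! ### The subdifferential of the positive part -/

/-- The convex subdifferential of `t ↦ max 0 t` at `b`. -/
def maxZeroSubdiff (b : ℝ) : Set ℝ :=
  {t | t ∈ Set.Icc (0 : ℝ) 1 ∧ (b < 0 → t = 0) ∧ (0 < b → t = 1)}

theorem convex_maxZeroSubdiff (b : ℝ) : Convex ℝ (maxZeroSubdiff b) := by
  rintro s ⟨hs, hs0, hs1⟩ t ⟨ht, ht0, ht1⟩ a c ha hc hac
  refine ⟨convex_Icc 0 1 hs ht ha hc hac, fun h => ?_, fun h => ?_⟩
  · simp [hs0 h, ht0 h]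
  · simp [hs1 h, ht1 h, hac]

theorem isCompact_maxZeroSubdiff (b : ℝ) : IsCompact (maxZeroSubdiff b) := by
  have : maxZeroSubdiff b =
      Set.Icc 0 1 ∩ ({t | b < 0 → t = 0} ∩ {t | 0 < b → t = 1}) := rfl
  rw [this]
  refine isCompact_Icc.inter_right (IsClosed.inter ?_ ?_)
  · exact isClosed_imp isOpen_const (isClosed_eq continuous_id continuous_const)
  · exact isClosed_imp isOpen_const (isClosed_eq continuous_id continuous_const)

/-- The right derivative of `max 0 ∘ ψ` is `μ * c` for some `μ` in the subdifferential; when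
`ψ 0 = 0`, the choice of `μ` depends on the sign of `c`. -/
theorem exists_mem_maxZeroSubdiff_tendsto {ψ : ℝ → ℝ} {c : ℝ} (hψ : HasDerivAt ψ c 0) :
    ∃ μ ∈ maxZeroSubdiff (ψ 0),
      Tendsto (fun τ => τ⁻¹ * (max 0 (ψ τ) - max 0 (ψ 0))) (𝓝[>] 0) (𝓝 (μ * c)) := by
  have hslope : Tendsto (fun τ => τ⁻¹ * (ψ τ - ψ 0)) (𝓝[>] 0) (𝓝 c) := by
    simpa using hψ.tendsto_slope_zero_right
  have hcont : Tendsto ψ (𝓝[>] 0) (𝓝 (ψ 0)) := hψ.continuousAt.tendsto.mono_left nhdsWithin_le_nhds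
  rcases lt_trichotomy (ψ 0) 0 with h | h | h
  · refine ⟨0, ⟨by simp, by simp, fun h' => absurd h' h.not_gt⟩, ?_⟩
    refine tendsto_const_nhds.congr' ?_
    filter_upwards [hcont.eventually_lt_const h] with τ hτ
    rw [max_eq_left hτ.le, max_eq_left h.le]
    simp
  · have hmax : Tendsto (fun τ => τ⁻¹ * (max 0 (ψ τ) - max 0 (ψ 0))) (𝓝[>] 0) (𝓝 (max 0 c)) := by
      refine (tendsto_const_nhds.max hslope).congr' ?_
      filter_upwards [self_mem_nhdsWithin] with τ hτ
      have hτ' : 0 ≤ τ⁻¹ := inv_nonneg.2 (le_of_lt hτ)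
      rw [h, max_self, sub_zero, sub_zero, mul_max_of_nonneg _ _ hτ', mul_zero]
    rcases le_total 0 c with hc | hc
    · exact ⟨1, ⟨by simp, by simp [h], by simp⟩, by simpa [max_eq_right hc] using hmax⟩
    · exact ⟨0, ⟨by simp, by simp, by simp [h]⟩, by simpa [max_eq_left hc] using hmax⟩
  · refine ⟨1, ⟨by simp, fun h' => absurd h' h.not_gt, by simp⟩, ?_⟩
    rw [one_mul]
    refine hslope.congr' ?_
    filter_upwards [hcont.eventually_const_lt h] with τ hτ
    rw [max_eq_right hτ.le, max_eq_right h.le]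

/-! ### Regular subgradients of the marginal function -/

section Subgradient

variable {E ι : Type*} [NormedAddCommGroup E] [InnerProductSpace ℝ E] [Fintype ι]

theorem tendsto_add_smul_nhdsGT {F : Type*} [NormedAddCommGroup F] [NormedSpace ℝ F] (u w : F) :
    Tendsto (fun τ : ℝ => u + τ • w) (𝓝[>] 0) (𝓝 u) := by
  have : Continuous fun τ : ℝ => u + τ • w := by fun_prop
  simpa using (this.tendsto 0).mono_left nhdsWithin_le_nhds

/-- A regular subgradient lies below every right derivative, along a ray, of a function that
majorizes `f` and touches it at the base point. -/
theorem IsRegularSubgradient.inner_le {f : E → ℝ} {u v w : E}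
    (hv : IsRegularSubgradient f u v) {Φ : ℝ → ℝ} {D : ℝ} (hu : Φ 0 = f u)
    (hle : ∀ᶠ τ in 𝓝[>] (0 : ℝ), f (u + τ • w) ≤ Φ τ)
    (hD : Tendsto (fun τ => τ⁻¹ * (Φ τ - Φ 0)) (𝓝[>] 0) (𝓝 D)) :
    inner ℝ v w ≤ D := by
  have hbound : ∀ ε : ℝ, 0 < ε → inner ℝ v w - ε * ‖w‖ ≤ D := fun ε hε => by
    refine ge_of_tendsto hD ?_
    filter_upwards [(tendsto_add_smul_nhdsGT u w).eventually (hv ε hε), hle,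
      self_mem_nhdsWithin] with τ h1 h2 hτ
    have hτ : 0 < τ := hτ
    rw [add_sub_cancel_left, inner_smul_right, norm_smul, Real.norm_of_nonneg hτ.le] at h1
    rw [le_inv_mul_iff₀ hτ, hu]
    linarith
  have hlim : Tendsto (fun ε : ℝ => inner ℝ v w - ε * ‖w‖) (𝓝[>] 0) (𝓝 (inner ℝ v w)) := by
    have : Continuous fun ε : ℝ => inner ℝ v w - ε * ‖w‖ := by fun_prop
    simpa using (this.tendsto 0).mono_left nhdsWithin_le_nhds
  exact le_of_tendsto hlim (by
    filter_upwards [self_mem_nhdsWithin] with ε hε using hbound ε hε)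

/-- Multiplier rule at a regular subgradient of a marginal function: `(0, v)` is a subgradient of
the joint objective in `(γ, x)`, hence a combination of the gradients of its smooth pieces. -/
theorem IsRegularSubgradient.exists_multipliers [CompleteSpace E] {f : E → ℝ} {u v : E}
    (hv : IsRegularSubgradient f u v) {p : ι → ℝ} {g : ι → E → ℝ}
    (hg : ∀ i, DifferentiableAt ℝ (g i) u) {γ : ℝ} (hγ : 0 < γ)
    (hu : f u = bufferedObjective p (fun i => g i u) γ)
    (hle : ∀ᶠ x in 𝓝 u, ∀ t, 0 ≤ t → f x ≤ bufferedObjective p (fun i => g i x) t) :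
    ∃ μ : ι → ℝ, (∀ i, μ i ∈ maxZeroSubdiff (γ * g i u + 1)) ∧
      v = γ • ∑ i, (p i * μ i) • gradient (g i) u ∧ ∑ i, p i * μ i * g i u = 0 := by
  let B : Set (ι → ℝ) := Set.pi Set.univ fun i => maxZeroSubdiff (γ * g i u + 1)
  let A : (ι → ℝ) →ₗ[ℝ] ℝ × E :=
    ∑ i, (LinearMap.proj i).smulRight (p i * g i u, (γ * p i) • gradient (g i) u)
  have hA : ∀ μ, A μ = ∑ i, μ i • (p i * g i u, (γ * p i) • gradient (g i) u) := fun μ => by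
    simp [A, LinearMap.sum_apply]
  have hBc : Convex ℝ (A '' B) :=
    (convex_pi fun i _ => convex_maxZeroSubdiff _).linear_image A
  have hBk : IsCompact (A '' B) :=
    (isCompact_univ_pi fun i => isCompact_maxZeroSubdiff _).image A.continuous_of_finiteDimensional
  have hmem : ((0 : ℝ), v) ∈ A '' B := by
    by_contra hnot
    obtain ⟨ℓ, r, hr1, hr2⟩ := geometric_hahn_banach_closed_point hBc hBk.isClosed hnot
    -- Write the separating functional as `(τ, x) ↦ τ s + ⟪w, x⟫`.
    let s : ℝ := ℓ (1, 0)
    let w : E := (InnerProductSpace.toDual ℝ E).symm (ℓ.comp (ContinuousLinearMap.inr ℝ ℝ E))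
    have hℓ : ∀ a x, ℓ (a, x) = a * s + inner ℝ w x := fun a x => by
      have h1 : inner ℝ w x = ℓ (0, x) := by
        simp [w, InnerProductSpace.toDual_symm_apply]
      have h2 : ((a, x) : ℝ × E) = a • (1, 0) + (0, x) := by simp
      rw [h1, h2, map_add, map_smul, smul_eq_mul]
    let ψ : ι → ℝ → ℝ := fun i τ => (γ + τ * s) * g i (u + τ • w) + 1
    have hψ0 : ∀ i, ψ i 0 = γ * g i u + 1 := fun i => by simp [ψ]
    have hψ : ∀ i, HasDerivAt (ψ i) (s * g i u + γ * inner ℝ (gradient (g i) u) w) 0 := fun i => by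
      have hline : HasDerivAt (fun τ : ℝ => u + τ • w) w 0 := by
        simpa using ((hasDerivAt_id (0 : ℝ)).smul_const w).const_add u
      have hgi : HasFDerivAt (g i) (InnerProductSpace.toDual ℝ E (gradient (g i) u))
          (u + (0 : ℝ) • w) := by
        simpa using (hg i).hasGradientAt.hasFDerivAt
      have h1 : HasDerivAt (fun τ : ℝ => g i (u + τ • w)) (inner ℝ (gradient (g i) u) w) 0 := by
        exact hgi.comp_hasDerivAt (0 : ℝ) hline
      have h2 : HasDerivAt (fun τ : ℝ => γ + τ * s) s 0 := by
        simpa using ((hasDerivAt_id (0 : ℝ)).mul_const s).const_add γ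
      simpa [ψ] using (h2.mul h1).add_const 1
    choose μ hμ hμlim using fun i => exists_mem_maxZeroSubdiff_tendsto (hψ i)
    have hμB : μ ∈ B := fun i _ => by simpa [hψ0] using hμ i
    let Φ : ℝ → ℝ := fun τ => bufferedObjective p (fun i => g i (u + τ • w)) (γ + τ * s)
    have hΦ : Tendsto (fun τ => τ⁻¹ * (Φ τ - Φ 0)) (𝓝[>] 0) (𝓝 (∑ i, p i *
        (μ i * (s * g i u + γ * inner ℝ (gradient (g i) u) w)))) := by
      refine (tendsto_finsetSum Finset.univ fun i _ => (hμlim i).const_mul (p i)).congr fun τ => ?_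
      simp only [Φ, bufferedObjective, ← Finset.sum_sub_distrib, Finset.mul_sum, ψ]
      exact Finset.sum_congr rfl fun i _ => by ring
    have hle' : ∀ᶠ τ in 𝓝[>] (0 : ℝ), f (u + τ • w) ≤ Φ τ := by
      have hγτ : ∀ᶠ τ in 𝓝[>] (0 : ℝ), 0 < γ + τ * s := by
        exact (tendsto_add_smul_nhdsGT γ s).eventually_const_lt hγ
      filter_upwards [(tendsto_add_smul_nhdsGT u w).eventually hle, hγτ]
        with τ h1 h2 using h1 _ h2.le
    have hkey := hv.inner_le (w := w) (by simp [Φ, hu]) hle' hΦ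
    have h3 := hr1 _ ⟨μ, hμB, rfl⟩
    rw [hℓ, zero_mul, zero_add, real_inner_comm] at hr2
    have h4 : ℓ (A μ) =
        ∑ i, p i * (μ i * (s * g i u + γ * inner ℝ (gradient (g i) u) w)) := by
      rw [hA, map_sum]
      refine Finset.sum_congr rfl fun i _ => ?_
      rw [map_smul, hℓ, inner_smul_right, smul_eq_mul, real_inner_comm w]
      ring
    linarith
  obtain ⟨μ, hμ, hAμ⟩ := hmem
  rw [hA] at hAμ
  refine ⟨μ, fun i => hμ i trivial, ?_, ?_⟩
  · have := congrArg Prod.snd hAμ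
    simp only [Prod.snd_sum] at this
    rw [← this, Finset.smul_sum]
    refine Finset.sum_congr rfl fun i _ => ?_
    simp only [Prod.smul_snd, smul_smul]
    congr 1; ring
  · have := congrArg Prod.fst hAμ
    simp only [Prod.fst_sum] at this
    rw [← this]
    refine Finset.sum_congr rfl fun i _ => ?_
    simp only [Prod.smul_fst, smul_eq_mul]; ring

end Subgradient

/-! ### Passage to limiting subgradients -/

theorem ContDiffAt.continuousAt_gradient {E : Type*} [NormedAddCommGroup E]
    [InnerProductSpace ℝ E] [CompleteSpace E] {f : E → ℝ} {x : E} (hf : ContDiffAt ℝ 1 f x) :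
    ContinuousAt (gradient f) x :=
  (InnerProductSpace.toDual ℝ E).symm.continuous.continuousAt.comp
    (hf.fderiv_right (m := 0) (by simp)).continuousAt

theorem theorem1 {Ω : Type*} [MeasurableSpace Ω] (P : Measure Ω) [IsProbabilityMeasure P]
    {m n ν : ℕ} (ξ : Ω → EuclideanSpace ℝ (Fin m)) (hξ : Measurable ξ)
    (g : EuclideanSpace ℝ (Fin m) → EuclideanSpace ℝ (Fin n) → ℝ)
    (xhat : EuclideanSpace ℝ (Fin n))
    (outcome : Fin ν → EuclideanSpace ℝ (Fin m)) (p : Fin ν → ℝ) (hp : ∀ i, 0 < p i)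
    (hlaw : P.map ξ = ∑ i, ENNReal.ofReal (p i) • Measure.dirac (outcome i))
    (hsmooth : ∀ i, ContDiffAt ℝ 1 (g (outcome i)) xhat)
    (hmean : ∫ ω, g (ξ ω) xhat ∂P < 0)
    (hpos : ∃ i, 0 < g (outcome i) xhat)
    (y : EuclideanSpace ℝ (Fin n))
    (hy : y ∈ limitingSubdifferential (fun x => bufferedProb P (fun ω => g (ξ ω) x)) xhat) :
    ∃ γ ∈ bufferedArgmin P (fun ω => g (ξ ω) xhat), ∃ μ : Fin ν → ℝ,
      (∀ i, μ i ∈ Set.Icc (0 : ℝ) 1) ∧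
      y = γ • ∑ i, (p i * μ i) • gradient (g (outcome i)) xhat ∧
      ∑ i, p i * μ i * g (outcome i) xhat = 0 ∧
      ∀ i, (γ * g (outcome i) xhat + 1 < 0 → μ i = 0) ∧
        (0 < γ * g (outcome i) xhat + 1 → μ i = 1) := by
  have hfin (x) : HasFiniteLaw P (fun ω => g (ξ ω) x) p (fun i => g (outcome i) x) :=
    hasFiniteLaw_comp hξ (fun i => (hp i).le) hlaw fun e => g e x
  have hcont i : ContinuousAt (g (outcome i)) xhat := (hsmooth i).continuousAt
  obtain ⟨j, hj⟩ := hpos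
  rw [(hfin xhat).integral_eq] at hmean
  obtain ⟨u, v, hu, -, hv, hvy⟩ := hy
  -- The minimization formula is available near `xhat`, since its hypotheses are open conditions.
  have hformula : ∀ᶠ x in 𝓝 xhat, ∃ γ, 0 < γ ∧
      bufferedProb P (fun ω => g (ξ ω) x) = bufferedObjective p (fun i => g (outcome i) x) γ ∧
      ∀ t, 0 ≤ t → bufferedObjective p (fun i => g (outcome i) x) γ ≤
        bufferedObjective p (fun i => g (outcome i) x) t := by
    have hmeancont : ContinuousAt (fun x => ∑ i, p i * g (outcome i) x) xhat := by fun_prop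
    filter_upwards [hmeancont.tendsto.eventually_lt_const hmean,
      (hcont j).tendsto.eventually_const_lt hj] with x hx1 hx2
    exact (hfin x).bufferedProb_eq hp hx1 ⟨j, hx2⟩
  have hdiff : ∀ᶠ x in 𝓝 xhat, ∀ i, DifferentiableAt ℝ (g (outcome i)) x :=
    eventually_all.2 fun i => ((hsmooth i).eventually (by simp)).mono fun x hx =>
      hx.differentiableAt (by simp)
  let δ := g (outcome j) xhat / 2
  have hδ : 0 < δ := half_pos hj
  let R := 1 / (p j * δ)
  -- Multipliers at regular subgradients near `xhat`, confined to a fixed compact box.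
  have hloc : ∀ᶠ x in 𝓝 xhat, ∀ v,
      IsRegularSubgradient (fun x => bufferedProb P (fun ω => g (ξ ω) x)) x v →
      ∃ γμ : ℝ × (Fin ν → ℝ), γμ ∈ Set.Icc 0 R ×ˢ Set.Icc (0 : Fin ν → ℝ) 1 ∧
        (∀ t, 0 ≤ t → bufferedObjective p (fun i => g (outcome i) x) γμ.1 ≤
          bufferedObjective p (fun i => g (outcome i) x) t) ∧
        (∀ i, γμ.2 i ∈ maxZeroSubdiff (γμ.1 * g (outcome i) x + 1)) ∧
        v = γμ.1 • ∑ i, (p i * γμ.2 i) • gradient (g (outcome i)) x ∧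
        ∑ i, p i * γμ.2 i * g (outcome i) x = 0 := by
    filter_upwards [hformula, hformula.eventually_nhds, hdiff,
      (hcont j).tendsto.eventually_const_lt (half_lt_self hj)]
      with x ⟨γ, hγ, heq, hmin⟩ hnear hd hxj v hv
    obtain ⟨μ, hμ, h1, h2⟩ := hv.exists_multipliers hd hγ heq (hnear.mono fun z hz t ht => by
      obtain ⟨γ', -, heq', hmin'⟩ := hz
      exact heq'.trans_le (hmin' t ht))
    refine ⟨(γ, μ), ⟨⟨hγ.le, ?_⟩, fun i => (hμ i).1.1, fun i => (hμ i).1.2⟩, hmin, hμ, h1, h2⟩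
    -- The minimal value is at most `1`, the value at the origin, whence the bound on `γ`.
    have h3 := bufferedObjective_ge (z := fun i => g (outcome i) x) (fun i => (hp i).le) j γ
    have h4 := (hmin 0 le_rfl).trans_eq (bufferedObjective_zero (hfin x).sum_eq_one)
    have hpj := hp j
    have h5 : γ * (p j * δ) ≤ γ * (p j * g (outcome j) x) := by
      have : δ < g (outcome j) x := hxj
      gcongr
    rw [le_div_iff₀ (mul_pos hpj hδ)]
    nlinarith
  obtain ⟨N, hN⟩ := eventually_atTop.1 (hu.eventually hloc)
  choose γμ hbox hmin hsub heq hzero using fun k =>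
    hN (k + N) (Nat.le_add_left N k) (v (k + N)) (hv (k + N))
  obtain ⟨⟨γ, μ⟩, hlim, φ, hφ, hγμ⟩ :=
    (isCompact_Icc.prod isCompact_Icc).tendsto_subseq hbox
  have hshift : Tendsto (fun k => φ k + N) atTop atTop :=
    (tendsto_add_atTop_nat N).comp hφ.tendsto_atTop
  have hux : Tendsto (fun k => u (φ k + N)) atTop (𝓝 xhat) := hu.comp hshift
  have hγ : Tendsto (fun k => (γμ (φ k)).1) atTop (𝓝 γ) := (continuous_fst.tendsto _).comp hγμ
  have hμ i : Tendsto (fun k => (γμ (φ k)).2 i) atTop (𝓝 (μ i)) :=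
    (((continuous_apply i).comp continuous_snd).tendsto _).comp hγμ
  have hgx i : Tendsto (fun k => g (outcome i) (u (φ k + N))) atTop (𝓝 (g (outcome i) xhat)) :=
    (hcont i).tendsto.comp hux
  have hcrit i : Tendsto (fun k => (γμ (φ k)).1 * g (outcome i) (u (φ k + N)) + 1) atTop
      (𝓝 (γ * g (outcome i) xhat + 1)) := (hγ.mul (hgx i)).add_const 1
  refine ⟨γ, ⟨hlim.1.1, fun t ht => ?_⟩, μ, fun i => ⟨hlim.2.1 i, hlim.2.2 i⟩, ?_, ?_,
    fun i => ⟨fun hi => ?_, fun hi => ?_⟩⟩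
  · have hobj : ∀ {s : ℕ → ℝ} {a : ℝ}, Tendsto s atTop (𝓝 a) →
        Tendsto (fun k => bufferedObjective p (fun i => g (outcome i) (u (φ k + N))) (s k)) atTop
          (𝓝 (bufferedObjective p (fun i => g (outcome i) xhat) a)) := fun hs =>
      tendsto_finsetSum _ fun i _ =>
        (tendsto_const_nhds.max ((hs.mul (hgx i)).add_const 1)).const_mul _
    have hle := le_of_tendsto_of_tendsto' (hobj hγ) (hobj (tendsto_const_nhds (x := t)))
      fun k => hmin (φ k) t ht
    have hint a := (hfin xhat).integral_comp fun s => max 0 (a * s + 1)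
    simpa only [Set.mem_ofPred_eq, hint, bufferedObjective] using hle
  · refine tendsto_nhds_unique (hvy.comp hshift) ?_
    refine Tendsto.congr (fun k => (heq (φ k)).symm) (hγ.smul ?_)
    exact tendsto_finsetSum _ fun i _ => ((hμ i).const_mul (p i)).smul
      ((hsmooth i).continuousAt_gradient.tendsto.comp hux)
  · refine tendsto_nhds_unique ?_ (tendsto_const_nhds (x := (0 : ℝ)) (f := atTop (α := ℕ)))
    refine Tendsto.congr (fun k => hzero (φ k)) ?_
    exact tendsto_finsetSum _ fun i _ => ((hμ i).const_mul (p i)).mul (hgx i)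
  · refine tendsto_nhds_unique (hμ i) (tendsto_const_nhds.congr' ?_)
    filter_upwards [(hcrit i).eventually_lt_const hi] with k hk
    exact ((hsub (φ k) i).2.1 hk).symm
  · refine tendsto_nhds_unique (hμ i) (tendsto_const_nhds.congr' ?_)
    filter_upwards [(hcrit i).eventually_const_lt hi] with k hk
    exact ((hsub (φ k) i).2.2 hk).symm
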